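/- Let $\{0,1\}^*$ be the set of finite binary strings, with $|p|$ the length of $p$. A prefix-free machine is a partial recursive function $C\colon\{0,1\}^*\to\{0,1\}^*$ whose domain is prefix-free, i.e. no string in the domain is a prefix of another string in it. For a prefix-free machine $C$ and $s\in\{0,1\}^*$ let $H_C(s)=\min\{|p| : C(p)=s\}$ ($\infty$ if there is no such $p$). A prefix-free machine $U$ is optimal if for each prefix-free machine $C$ there is $d\in\mathbb{N}$ such that for every $p\in\operatorname{Dom} C$ there is $q$ with $U(q)=C(p)$ and $|q|\le|p|+d$. Identify each string $s$ with the natural number whose binary expansion is $1s$, minus $1$. Let $U$ be an optimal prefix-free machine and $b\colon\{0,1\}^*\times\{0,1\}^*\to\{0,1\}^*$ a bijective total recursive function, and put $H(n,s)=H_U(b(n,s))$ for $n\in\mathbb{N}$ and $s\in\{0,1\}^*$ (where $n$ is regarded as a string); this is always finite. For a prefix-free machine $C$ put $S_C(n,s)=\{p\in\{0,1\}^* : |p|\le n \text{ and } C(p)=s\}$. Theorem. For every prefix-free machine $C$ there exists $d\in\mathbb{N}$ such that $\# S_C(n,s)\le 2^{\,n-H(n,s)+d}$ for all $n\in\mathbb{N}$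 and all $s\in\{0,1\}^*$. -/

import Mathlib

namespace AIT

/-- A set of finite binary strings is prefix-free if no string in it is a prefix of another
string in it. -/
def PrefixFree (S : Set (List Bool)) : Prop :=
  ∀ p ∈ S, ∀ q ∈ S, p <+: q → p = q

/-- A prefix-free machine: a partial recursive function on finite binary strings whose domain of
definition is prefix-free. -/
structure IsPrefixFreeMachine (C : List Bool →. List Bool) : Prop where
  partrec : Partrec C
  prefixFree : PrefixFree C.Dom

/-- `H_C(s)`, the length of a shortest `p` with `C(p) = s`, and `⊤` if there is no such `p`. -/
noncomputable def H (C : List Bool →. List Bool) (s : List Bool) : ℕ∞ :=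
  ⨅ (p : List Bool) (_ : s ∈ C p), (p.length : ℕ∞)

/-- A prefix-free machine `U` is optimal if for each prefix-free machine `C` there is `d` such that
each `p` in the domain of `C` has a `q` with `U(q) = C(p)` and `|q| ≤ |p| + d`. -/
structure IsOptimal (U : List Bool →. List Bool) : Prop where
  machine : IsPrefixFreeMachine U
  optimal : ∀ C : List Bool →. List Bool, IsPrefixFreeMachine C →
    ∃ d : ℕ, ∀ p s : List Bool, s ∈ C p → ∃ q : List Bool, s ∈ U q ∧ q.length ≤ p.length + d

/-- The number with binary expansion `1s`, where the head of the list `s` is the leftmost bit. -/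
def oneConcat (s : List Bool) : ℕ :=
  s.foldl (fun m c => 2 * m + c.toNat) 1

/-- The string at position `n` in the length-lexicographic order `λ, 0, 1, 00, 01, 10, 11, …`
(with `0 = false` and `1 = true`), positions being counted from `0`. -/
def natToString (n : ℕ) : List Bool :=
  if n = 0 then [] else natToString ((n - 1) / 2) ++ [decide (n % 2 = 0)]
termination_by n
decreasing_by omega

theorem oneConcat_append (s : List Bool) (c : Bool) :
    oneConcat (s ++ [c]) = 2 * oneConcat s + c.toNat := by
  simp [oneConcat]

theorem oneConcat_pos (s : List Bool) : 0 < oneConcat s := by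
  induction s using List.reverseRecOn with
  | nil => simp [oneConcat]
  | append_singleton s c ih => rw [oneConcat_append]; omega

theorem natToString_oneConcat (s : List Bool) : natToString (oneConcat s - 1) = s := by
  induction s using List.reverseRecOn with
  | nil => rw [natToString]; simp [oneConcat]
  | append_singleton s c ih =>
    have h := oneConcat_pos s
    rw [natToString, oneConcat_append]
    have h0 : 2 * oneConcat s + c.toNat - 1 ≠ 0 := by omega
    have h1 : (2 * oneConcat s + c.toNat - 1 - 1) / 2 = oneConcat s - 1 := by
      cases c <;> simp only [Bool.toNat_false, Bool.toNat_true] <;> omega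
    have h2 : decide ((2 * oneConcat s + c.toNat - 1) % 2 = 0) = c := by
      cases c <;> simp only [Bool.toNat_false, Bool.toNat_true, decide_eq_true_eq,
        decide_eq_false_iff_not] <;> omega
    rw [if_neg h0, h1, h2, ih]

theorem oneConcat_natToString (n : ℕ) : oneConcat (natToString n) = n + 1 := by
  induction n using Nat.strong_induction_on with
  | _ n ih =>
    rw [natToString]
    split_ifs with h
    · simp [oneConcat, h]
    · rw [oneConcat_append, ih _ (by omega)]
      rcases Nat.mod_two_eq_zero_or_one n with h2 | h2 <;> simp [h2] <;> omega

/-- The identification of finite binary strings with natural numbers, `s ↦ 1s - 1`. -/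
def stringEquivNat : List Bool ≃ ℕ where
  toFun s := oneConcat s - 1
  invFun := natToString
  left_inv := natToString_oneConcat
  right_inv n := by simp [oneConcat_natToString]

/-- `S_C(n, s)`, the set of all `p` of length at most `n` with `C(p) = s`. -/
def codewords (C : List Bool →. List Bool) (n : ℕ) (s : List Bool) : Set (List Bool) :=
  {p | p.length ≤ n ∧ s ∈ C p}

theorem codewords_finite (C : List Bool →. List Bool) (n : ℕ) (s : List Bool) :
    (codewords C n s).Finite :=
  (List.finite_length_le Bool n).subset fun _ hp => hp.1

end AIT

/-!
The argument is the coding theorem for a computably enumerable family of weights, in the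
Kraft–Chaitin form. The pairs `(n, s)` receive the weights `2 ^ (-n) * #S_C(n, s)`, and their total
is `∑_p ∑_{n ≥ |p|} 2 ^ (-n) = 2 * ∑_p 2 ^ (-|p|) ≤ 2` by the Kraft inequality for the domain of `C`
(`kraft_inequality`).

The graph of `C` is enumerated without repetitions (`exists_enumeration`). Whenever the number of
elements found in `S_C(n, s)` reaches a power of two, `2 ^ k`, a codeword of length `n + 2 - k` is
requested for `b(n, s)`. The powers of two up to a number sum to at most twice that number, so the
requests have total weight at most `1` (`tsum_weight_request_le`), and a single prefix-free machine
`M` serves them all with codewords one bit longer than requested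
(`exists_prefixFreeMachine_of_requests`). It does so without any bookkeeping of free strings: the
requests take consecutive intervals of lengths `2 ^ (-L)`, and the codeword is a dyadic interval of
length `2 ^ (-(L + 1))` inside.

If `2 ^ k ≤ #S_C(n, s) < 2 ^ (k + 1)`, then `M` has a program of length `n + 3 - k` for `b(n, s)`,
whence `H(n, s) ≤ n + 3 - k + d` by the optimality of `U`, which is the bound in question.
-/

open scoped ENNReal NNReal

namespace AIT

/-! ### Cylinders and the Kraft inequality -/

theorem oneConcat_append_le (p r : List Bool) :
    oneConcat p * 2 ^ r.length ≤ oneConcat (p ++ r) ∧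
      oneConcat (p ++ r) + 1 ≤ (oneConcat p + 1) * 2 ^ r.length := by
  induction r using List.reverseRecOn with
  | nil => simp
  | append_singleton r c ih =>
    rw [← List.append_assoc, oneConcat_append, List.length_append, List.length_singleton,
      pow_succ, ← mul_assoc, ← mul_assoc]
    cases c <;> simp only [Bool.toNat_false, Bool.toNat_true] <;> omega

theorem two_pow_length_le_oneConcat (p : List Bool) :
    2 ^ p.length ≤ oneConcat p ∧ oneConcat p + 1 ≤ 2 * 2 ^ p.length := by
  simpa [oneConcat] using oneConcat_append_le [] p

theorem oneConcat_injective : Function.Injective oneConcat := fun p q h => by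
  rw [← natToString_oneConcat p, h, natToString_oneConcat]

/-- The dyadic interval of those reals in `[1, 2)` whose binary expansion starts with `1.p`. Its
length is `2 ^ (-|p|)`. -/
def cylinder (p : List Bool) : Set ℝ :=
  Set.Ico ((oneConcat p : ℝ) / 2 ^ p.length) ((oneConcat p + 1 : ℝ) / 2 ^ p.length)

theorem cylinder_nonempty (p : List Bool) : (cylinder p).Nonempty := by
  rw [cylinder, Set.nonempty_Ico]
  gcongr
  linarith

theorem cylinder_subset_of_prefix {p q : List Bool} (h : p <+: q) : cylinder q ⊆ cylinder p := by
  obtain ⟨r, rfl⟩ := h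
  obtain ⟨h1, h2⟩ := oneConcat_append_le p r
  have h1' : (oneConcat p : ℝ) * 2 ^ r.length ≤ oneConcat (p ++ r) := by exact_mod_cast h1
  have h2' : (oneConcat (p ++ r) + 1 : ℝ) ≤ (oneConcat p + 1) * 2 ^ r.length := by
    exact_mod_cast h2
  apply Set.Ico_subset_Ico
  · rw [List.length_append, pow_add, div_le_div_iff₀ (by positivity) (by positivity)]
    calc _ = (oneConcat p : ℝ) * 2 ^ r.length * 2 ^ p.length := by ring
      _ ≤ _ := by gcongr
  · rw [List.length_append, pow_add, div_le_div_iff₀ (by positivity) (by positivity)]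
    calc _ ≤ (oneConcat p + 1 : ℝ) * 2 ^ r.length * 2 ^ p.length := by gcongr
      _ = _ := by ring

theorem cylinder_subset_Ico (p : List Bool) : cylinder p ⊆ Set.Ico 1 2 := by
  have h := cylinder_subset_of_prefix (List.nil_prefix (l := p))
  have h0 : cylinder [] = Set.Ico 1 2 := by norm_num [cylinder, oneConcat]
  rwa [h0] at h

theorem disjoint_cylinder_of_length_eq {p q : List Bool} (hl : p.length = q.length) (h : p ≠ q) :
    Disjoint (cylinder p) (cylinder q) := by
  have key : ∀ p q : List Bool, p.length = q.length → oneConcat p < oneConcat q →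
      Disjoint (cylinder p) (cylinder q) := by
    intro p q hl hlt
    rw [Set.disjoint_left]
    rintro x ⟨-, hx⟩ ⟨hx', -⟩
    have hle : (oneConcat p + 1 : ℝ) ≤ oneConcat q := by exact_mod_cast hlt
    refine absurd (hx.trans_le ?_) (not_lt.2 hx')
    rw [hl]
    gcongr
  rcases lt_or_gt_of_ne (oneConcat_injective.ne h) with hlt | hlt
  · exact key p q hl hlt
  · exact (key q p hl.symm hlt).symm

theorem disjoint_cylinder {p q : List Bool} (h : ¬ p <+: q) (h' : ¬ q <+: p) :
    Disjoint (cylinder p) (cylinder q) := by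
  have key : ∀ p q : List Bool, p.length ≤ q.length → ¬ p <+: q →
      Disjoint (cylinder p) (cylinder q) := by
    intro p q hl hpq
    have hne : p ≠ q.take p.length := fun he => hpq (he ▸ List.take_prefix _ _)
    exact (disjoint_cylinder_of_length_eq (by simp [hl]) hne).mono_right
      (cylinder_subset_of_prefix (List.take_prefix _ _))
  rcases le_total p.length q.length with hl | hl
  · exact key p q hl h
  · exact (key q p hl h').symm

theorem volume_cylinder (p : List Bool) :
    MeasureTheory.volume (cylinder p) = (2⁻¹ : ℝ≥0∞) ^ p.length := by
  rw [cylinder, Real.volume_Ico, add_div, add_sub_cancel_left, one_div, ← inv_pow,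
    ENNReal.ofReal_pow (by norm_num), ENNReal.ofReal_inv_of_pos (by norm_num)]
  simp

/-- The Kraft inequality, for a prefix-free family of strings: the cylinders of its members are
disjoint subsets of `[1, 2)`. -/
theorem kraft_inequality {ι : Type*} [Countable ι] (f : ι → List Bool)
    (hf : ∀ i j, f i <+: f j → i = j) : ∑' i, (2⁻¹ : ℝ≥0∞) ^ (f i).length ≤ 1 := by
  have hd : Pairwise (Function.onFun Disjoint fun i => cylinder (f i)) := fun i j hij =>
    disjoint_cylinder (fun h => hij (hf i j h)) (fun h => hij (hf j i h).symm)
  calc ∑' i, (2⁻¹ : ℝ≥0∞) ^ (f i).length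
      = MeasureTheory.volume (⋃ i, cylinder (f i)) := by
        rw [MeasureTheory.measure_iUnion hd fun i => measurableSet_Ico]
        exact tsum_congr fun i => (volume_cylinder _).symm
    _ ≤ MeasureTheory.volume (Set.Ico (1 : ℝ) 2) :=
        MeasureTheory.measure_mono (Set.iUnion_subset fun i => cylinder_subset_Ico _)
    _ = 1 := by rw [Real.volume_Ico]; norm_num

/-! ### Computability of the arithmetic involved -/

theorem primrec_pow : Primrec₂ ((· ^ ·) : ℕ → ℕ → ℕ) :=
  Primrec₂.unpaired'.1 Nat.Primrec.pow

theorem primrec_log_two : Primrec (Nat.log 2) := by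
  have h : PrimrecRel fun c k : ℕ => 2 ^ k ≤ c :=
    Primrec.nat_le.comp₂ (primrec_pow.comp₂ (Primrec₂.const 2) Primrec₂.right) Primrec₂.left
  refine (Primrec.nat_findGreatest Primrec.id h).of_eq fun c => ?_
  rcases Nat.eq_zero_or_pos c with rfl | hc
  · simp
  · rw [id, Nat.findGreatest_eq_iff]
    refine ⟨Nat.log_le_self 2 c, fun _ => Nat.pow_log_le_self 2 hc.ne', fun k hk _ hle => ?_⟩
    exact absurd (Nat.le_log_of_pow_le (by norm_num) hle) (not_le.2 hk)

theorem primrec_oneConcat : Primrec oneConcat := by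
  have hg : Primrec₂ fun (_ : List Bool) (x : ℕ × Bool) => 2 * x.1 + x.2.toNat :=
    (Primrec.nat_add.comp (Primrec.nat_double.comp (Primrec.fst.comp Primrec.snd))
      ((Primrec.dom_bool Bool.toNat).comp (Primrec.snd.comp Primrec.snd))).to₂
  exact Primrec.list_foldl Primrec.id (Primrec.const 1) hg

theorem computable_natToString : Computable natToString := by
  -- `natToString` inverts the computable bijection `s ↦ 1s - 1`, so a search finds its values.
  have hf : Computable₂ fun (n m : ℕ) => (Encodable.decode (α := List Bool) m).bind fun s =>
      if oneConcat s = n + 1 then some s else none := by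
    refine (Primrec.option_bind (f := fun z : ℕ × ℕ => Encodable.decode (α := List Bool) z.2)
      (g := fun z s => if oneConcat s = z.1 + 1 then some s else none)
      (Primrec.decode.comp Primrec.snd) ?_).to_comp.to₂
    exact (Primrec.ite (Primrec.eq.comp (primrec_oneConcat.comp Primrec.snd)
      (Primrec.succ.comp (Primrec.fst.comp Primrec.fst)))
      (Primrec.option_some.comp Primrec.snd) (Primrec.const none)).to₂
  refine (Partrec.rfindOpt hf).of_eq_tot fun n => ?_
  have hd : (Nat.rfindOpt fun m => (Encodable.decode (α := List Bool) m).bind fun s =>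
      if oneConcat s = n + 1 then some s else none).Dom :=
    Nat.rfindOpt_dom.2 ⟨Encodable.encode (natToString n), natToString n, by
      simp [oneConcat_natToString]⟩
  obtain ⟨m, hm⟩ := Nat.rfindOpt_spec (Part.get_mem hd)
  simp only [Option.mem_def, Option.bind_eq_some_iff, Option.ite_none_right_eq_some,
    Option.some.injEq] at hm
  obtain ⟨s, -, hs, he⟩ := hm
  have : natToString n = s := by
    rw [← natToString_oneConcat s, hs, Nat.add_sub_cancel]
  rw [this, he]
  exact Part.get_mem hd

/-! ### Realising a list of requests by a prefix-free machine -/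

/-- The weight `2 ^ (-L)` of a request `(L, o)` for a codeword of length `L` with output `o`;
the absence of a request has weight `0`. -/
noncomputable def weight (r : Option (ℕ × List Bool)) : ℝ≥0 :=
  r.elim 0 fun x => 2⁻¹ ^ x.1

/-- The total weight of the requests before the `i`-th one, as a pair `(a, e)` which stands for the
dyadic rational `a / 2 ^ e`. -/
def startPair (R : ℕ → Option (ℕ × List Bool)) (i : ℕ) : ℕ × ℕ :=
  Nat.rec (0, 0)
    (fun j x => (R j).elim x fun r => (x.1 * 2 ^ r.1 + 2 ^ x.2, x.2 + r.1)) i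

theorem startPair_eq_sum (R : ℕ → Option (ℕ × List Bool)) (i : ℕ) :
    ((startPair R i).1 : ℝ) / 2 ^ (startPair R i).2 =
      ∑ j ∈ Finset.range i, (weight (R j) : ℝ) := by
  induction i with
  | zero => simp [startPair]
  | succ i ih =>
    rw [Finset.sum_range_succ, ← ih]
    have hs : startPair R (i + 1) = (R i).elim (startPair R i) fun r =>
      ((startPair R i).1 * 2 ^ r.1 + 2 ^ (startPair R i).2, (startPair R i).2 + r.1) := rfl
    rw [hs]
    cases R i with
    | none => simp [weight]
    | some r =>
      simp only [Option.elim_some, weight]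
      push_cast
      rw [pow_add, inv_pow]
      field_simp

theorem computable_startPair {R : ℕ → Option (ℕ × List Bool)} (hR : Computable R) :
    Computable (startPair R) := by
  have hstep : Primrec₂ fun (y : ℕ × ℕ) (r : ℕ × List Bool) =>
      (y.1 * 2 ^ r.1 + 2 ^ y.2, y.2 + r.1) := by
    have h1 : Primrec fun z : (ℕ × ℕ) × ℕ × List Bool => z.1.1 := Primrec.fst.comp Primrec.fst
    have h2 : Primrec fun z : (ℕ × ℕ) × ℕ × List Bool => z.1.2 := Primrec.snd.comp Primrec.fst
    have h3 : Primrec fun z : (ℕ × ℕ) × ℕ × List Bool => z.2.1 := Primrec.fst.comp Primrec.snd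
    exact (Primrec.pair
      (Primrec.nat_add.comp (Primrec.nat_mul.comp h1 (primrec_pow.comp (Primrec.const 2) h3))
        (primrec_pow.comp (Primrec.const 2) h2)) (Primrec.nat_add.comp h2 h3)).to₂
  have hg : Computable₂ fun (_ : ℕ) (x : ℕ × ℕ × ℕ) => (R x.1).elim x.2 fun r =>
      (x.2.1 * 2 ^ r.1 + 2 ^ x.2.2, x.2.2 + r.1) := by
    have hc : Computable fun z : ℕ × ℕ × ℕ × ℕ => z.2.2 := Computable.snd.comp Computable.snd
    refine Computable.of_eq (Computable.option_casesOn (hR.comp (Computable.fst.comp Computable.snd))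
      hc (hstep.to_comp.comp (hc.comp Computable.fst) Computable.snd).to₂) fun z => ?_
    cases h : R z.2.1 <;> simp [h]
  exact Computable.nat_rec Computable.id (Computable.const (0, 0)) hg

/-- The value of `1q`, where `q` is the codeword of length `L + 1` for a request of length `L`
when the previous requests have total weight `x.1 / 2 ^ x.2`: the cylinder of `q` is the first one
of its size beyond `1 + x.1 / 2 ^ x.2`. -/
def codeNumber (x : ℕ × ℕ) (L : ℕ) : ℕ :=
  2 ^ (L + 1) + (x.1 * 2 ^ (L + 1) / 2 ^ x.2 + 1)

theorem primrec_codeNumber : Primrec₂ codeNumber := by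
  have hL : Primrec fun z : (ℕ × ℕ) × ℕ => 2 ^ (z.2 + 1) :=
    primrec_pow.comp (Primrec.const 2) (Primrec.succ.comp Primrec.snd)
  exact (Primrec.nat_add.comp hL (Primrec.succ.comp (Primrec.nat_div.comp
    (Primrec.nat_mul.comp (Primrec.fst.comp Primrec.fst) hL)
    (primrec_pow.comp (Primrec.const 2) (Primrec.snd.comp Primrec.fst))))).to₂

/-- The output for the string `q` if `q` is the codeword of the `i`-th request. -/
def answer (R : ℕ → Option (ℕ × List Bool)) (q : List Bool) (i : ℕ) : Option (List Bool) :=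
  (R i).bind fun r =>
    if q.length = r.1 + 1 ∧ oneConcat q = codeNumber (startPair R i) r.1 then some r.2 else none

theorem answer_eq_some {R : ℕ → Option (ℕ × List Bool)} {q : List Bool} {i : ℕ} {o : List Bool} :
    answer R q i = some o ↔ ∃ L, R i = some (L, o) ∧ q.length = L + 1 ∧
      oneConcat q = codeNumber (startPair R i) L := by
  simp only [answer, Option.bind_eq_some_iff, Option.ite_none_right_eq_some, Option.some.injEq,
    Prod.exists]
  constructor
  · rintro ⟨L, o', h1, ⟨h2, h3⟩, rfl⟩
    exact ⟨L, h1, h2, h3⟩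
  · rintro ⟨L, h1, h2, h3⟩
    exact ⟨L, o, h1, ⟨h2, h3⟩, rfl⟩

theorem computable_answer {R : ℕ → Option (ℕ × List Bool)} (hR : Computable R) :
    Computable₂ (answer R) := by
  have hif : Primrec fun z : (List Bool × ℕ × ℕ) × ℕ × List Bool =>
      if z.1.1.length = z.2.1 + 1 ∧ oneConcat z.1.1 = codeNumber z.1.2 z.2.1
        then some z.2.2 else none := by
    have hq : Primrec fun z : (List Bool × ℕ × ℕ) × ℕ × List Bool => z.1.1 :=
      Primrec.fst.comp Primrec.fst
    have hL : Primrec fun z : (List Bool × ℕ × ℕ) × ℕ × List Bool => z.2.1 :=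
      Primrec.fst.comp Primrec.snd
    refine Primrec.ite (PrimrecPred.and ?_ ?_)
      (Primrec.option_some.comp (Primrec.snd.comp Primrec.snd)) (Primrec.const none)
    · exact Primrec.eq.comp (Primrec.list_length.comp hq) (Primrec.succ.comp hL)
    · exact Primrec.eq.comp (primrec_oneConcat.comp hq)
        (primrec_codeNumber.comp (Primrec.snd.comp Primrec.fst) hL)
  refine (Computable.option_bind (f := fun z : List Bool × ℕ => R z.2) (g := fun z r =>
    if z.1.length = r.1 + 1 ∧ oneConcat z.1 = codeNumber (startPair R z.2) r.1
      then some r.2 else none) (hR.comp Computable.snd) ?_).to₂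
  exact (hif.to_comp.comp (Computable.pair (Computable.pair
    (Computable.fst.comp Computable.fst)
    ((computable_startPair hR).comp (Computable.snd.comp Computable.fst))) Computable.snd)).to₂

theorem le_codeNumber (x : ℕ × ℕ) (L : ℕ) :
    (1 + (x.1 : ℝ) / 2 ^ x.2) * 2 ^ (L + 1) ≤ codeNumber x L := by
  have h : x.1 * 2 ^ (L + 1) < (x.1 * 2 ^ (L + 1) / 2 ^ x.2 + 1) * 2 ^ x.2 :=
    (Nat.div_lt_iff_lt_mul (by positivity)).1 (Nat.lt_succ_self _)
  rw [add_mul, one_mul, div_mul_eq_mul_div, codeNumber, Nat.cast_add, Nat.cast_pow, Nat.cast_ofNat]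
  gcongr
  rw [div_le_iff₀ (by positivity)]
  exact_mod_cast h.le

theorem codeNumber_add_one_le (x : ℕ × ℕ) (L : ℕ) :
    (codeNumber x L + 1 : ℝ) ≤ (1 + ((x.1 : ℝ) / 2 ^ x.2 + 2⁻¹ ^ L)) * 2 ^ (L + 1) := by
  have h : ((x.1 * 2 ^ (L + 1) / 2 ^ x.2 : ℕ) : ℝ) ≤ (x.1 : ℝ) / 2 ^ x.2 * 2 ^ (L + 1) := by
    refine Nat.cast_div_le.trans_eq ?_
    push_cast
    ring
  have h2 : (2⁻¹ : ℝ) ^ L * 2 ^ (L + 1) = 2 := by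
    rw [pow_succ, ← mul_assoc, ← mul_pow]
    norm_num
  rw [add_mul, add_mul, h2, one_mul, codeNumber]
  push_cast at h ⊢
  linarith

/-- The cylinder of the codeword of the `i`-th request lies in the `i`-th of the intervals that are
laid end to end from `1` on, with the weights of the requests as their lengths. -/
theorem cylinder_subset_of_answer {R : ℕ → Option (ℕ × List Bool)} {q : List Bool} {i : ℕ}
    {o : List Bool} (h : answer R q i = some o) :
    cylinder q ⊆ Set.Ico (1 + ∑ j ∈ Finset.range i, (weight (R j) : ℝ))
      (1 + ∑ j ∈ Finset.range (i + 1), (weight (R j) : ℝ)) := by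
  obtain ⟨L, hi, hl, hq⟩ := answer_eq_some.1 h
  rw [Finset.sum_range_succ, ← startPair_eq_sum, hi, cylinder, hl, hq]
  apply Set.Ico_subset_Ico
  · rw [le_div_iff₀ (by positivity)]
    exact le_codeNumber _ _
  · rw [div_le_iff₀ (by positivity)]
    simpa [weight] using codeNumber_add_one_le (startPair R i) L

/-- An effective converse of the Kraft inequality: a computable sequence of requests `(L, o)` of
total weight at most `1` is realised by a prefix-free machine, up to one additional bit. That bit
makes each interval of length `2 ^ (-L)` contain a cylinder of length `2 ^ (-(L + 1))`. -/
theorem exists_prefixFreeMachine_of_requests {R : ℕ → Option (ℕ × List Bool)} (hR : Computable R)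
    (hsum : ∑' i, (weight (R i) : ℝ≥0∞) ≤ 1) :
    ∃ M, IsPrefixFreeMachine M ∧ ∀ i L o, R i = some (L, o) →
      ∃ q, o ∈ M q ∧ q.length = L + 1 := by
  have hle : ∀ i, ∑ j ∈ Finset.range i, (weight (R j) : ℝ) ≤ 1 := fun i => by
    have := (ENNReal.sum_le_tsum (f := fun j => (weight (R j) : ℝ≥0∞)) (Finset.range i)).trans hsum
    exact_mod_cast this
  -- A codeword determines its request, as the intervals of distinct requests are disjoint.
  have huniq : ∀ {p q : List Bool} {i j : ℕ} {o o' : List Bool}, answer R p i = some o →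
      answer R q j = some o' → p <+: q → i = j := by
    intro p q i j o o' hp hq hpq
    obtain ⟨x, hx⟩ := cylinder_nonempty q
    have hxi := cylinder_subset_of_answer hp (cylinder_subset_of_prefix hpq hx)
    have hxj := cylinder_subset_of_answer hq hx
    have mono : ∀ {m n : ℕ}, m ≤ n → ∑ j ∈ Finset.range m, (weight (R j) : ℝ) ≤
        ∑ j ∈ Finset.range n, (weight (R j) : ℝ) := fun h =>
      Finset.sum_le_sum_of_subset_of_nonneg (Finset.range_mono h) fun _ _ _ => NNReal.coe_nonneg _
    rcases lt_trichotomy i j with h | h | h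
    · linarith [hxi.2, hxj.1, mono (Nat.succ_le_of_lt h)]
    · exact h
    · linarith [hxj.2, hxi.1, mono (Nat.succ_le_of_lt h)]
  refine ⟨fun q => Nat.rfindOpt (answer R q), ⟨Partrec.rfindOpt (computable_answer hR), ?_⟩, ?_⟩
  · intro p hp q hq hpq
    obtain ⟨i, o, hi⟩ := Nat.rfindOpt_dom.1 hp
    obtain ⟨j, o', hj⟩ := Nat.rfindOpt_dom.1 hq
    obtain rfl := huniq hi hj hpq
    obtain ⟨L, h1, -, h2⟩ := answer_eq_some.1 hi
    obtain ⟨L', h1', -, h2'⟩ := answer_eq_some.1 hj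
    obtain rfl : L = L' := by simpa using congrArg (Option.map Prod.fst) (h1.symm.trans h1')
    exact oneConcat_injective (h2.trans h2'.symm)
  · intro i L o hi
    set q := natToString (codeNumber (startPair R i) L - 1) with hqdef
    have hq : oneConcat q = codeNumber (startPair R i) L := by
      rw [hqdef, oneConcat_natToString, Nat.sub_add_cancel]
      exact Nat.le_add_left_of_le (Nat.le_add_left 1 _)
    have hl : q.length = L + 1 := by
      obtain ⟨h1, h2⟩ := two_pow_length_le_oneConcat q
      have h3 : 2 ^ (L + 1) ≤ oneConcat q := hq ▸ Nat.le_add_right _ _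
      have h4 : oneConcat q + 1 ≤ 2 ^ (L + 2) := by
        have h5 := codeNumber_add_one_le (startPair R i) L
        have h6 := hle (i + 1)
        rw [Finset.sum_range_succ, ← startPair_eq_sum, hi] at h6
        simp only [weight, Option.elim_some, NNReal.coe_pow, NNReal.coe_inv, NNReal.coe_ofNat] at h6
        rw [hq]
        have h7 : (codeNumber (startPair R i) L + 1 : ℝ) ≤ (1 + 1) * 2 ^ (L + 1) :=
          h5.trans (by gcongr)
        rw [one_add_one_eq_two, ← pow_succ'] at h7
        exact_mod_cast h7
      have h5 : q.length < L + 2 := (Nat.pow_lt_pow_iff_right (a := 2) (by norm_num)).1 (by omega)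
      have h6 : L + 1 < q.length + 1 :=
        (Nat.pow_lt_pow_iff_right (a := 2) (by norm_num)).1 (by rw [pow_succ' 2 q.length]; omega)
      omega
    have ha : answer R q i = some o := answer_eq_some.2 ⟨L, hi, hl, hq⟩
    have hd : (Nat.rfindOpt (answer R q)).Dom := Nat.rfindOpt_dom.2 ⟨i, o, ha⟩
    obtain ⟨j, hj⟩ := Nat.rfindOpt_spec (Part.get_mem hd)
    obtain rfl := huniq ha hj List.prefix_rfl
    obtain rfl := Option.some_injective _ (ha.symm.trans hj)
    exact ⟨q, Part.get_mem hd, hl⟩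

/-! ### Enumerating the graph of a machine -/

/-- The graph of a partial recursive function has a computable enumeration without repetitions. -/
theorem exists_enumeration {C : List Bool →. List Bool} (hC : Partrec C) :
    ∃ e : ℕ → Option (List Bool × List Bool), Computable e ∧
      (∀ p s, s ∈ C p ↔ ∃ t, e t = some (p, s)) ∧
      ∀ t t' x, e t = some x → e t' = some x → t = t' := by
  obtain ⟨c, hc⟩ := Nat.Partrec.Code.exists_code.1 hC
  have hev : ∀ p s, s ∈ C p ↔ Encodable.encode s ∈ c.eval (Encodable.encode p) := fun p s => by
    rw [hc]
    simp
  -- Stage `⟨u, m⟩` yields the `m`-th string if its computation halts at exactly the bound `u + 1`.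
  let e : ℕ → Option (List Bool × List Bool) := fun t =>
    if c.evaln t.unpair.1 (Encodable.encode (natToString t.unpair.2)) = none then
      (c.evaln (t.unpair.1 + 1) (Encodable.encode (natToString t.unpair.2))).bind fun w =>
        (Encodable.decode (α := List Bool) w).map fun s => (natToString t.unpair.2, s)
    else none
  have he : ∀ t p s, e t = some (p, s) ↔ p = natToString t.unpair.2 ∧
      c.evaln t.unpair.1 (Encodable.encode p) = none ∧
      ∃ w ∈ c.evaln (t.unpair.1 + 1) (Encodable.encode p),
        Encodable.decode (α := List Bool) w = some s := by
    intro t p s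
    simp only [e, Option.ite_none_right_eq_some, Option.bind_eq_some_iff, Option.map_eq_some_iff,
      Prod.mk.injEq, Option.mem_def]
    constructor
    · rintro ⟨h1, w, h2, s', h3, rfl, rfl⟩
      exact ⟨rfl, h1, w, h2, h3⟩
    · rintro ⟨rfl, h1, w, h2, h3⟩
      exact ⟨h1, w, h2, s, h3, rfl, rfl⟩
  refine ⟨e, ?_, fun p s => ⟨fun h => ?_, ?_⟩, ?_⟩
  · have hu : Computable fun t : ℕ => t.unpair.1 := Computable.fst.comp Computable.unpair
    have hp : Computable fun t : ℕ => natToString t.unpair.2 :=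
      computable_natToString.comp (Computable.snd.comp Computable.unpair)
    have hn : ∀ {f : ℕ → ℕ}, Computable f → Computable fun t : ℕ =>
        c.evaln (f t) (Encodable.encode (natToString t.unpair.2)) := fun hf =>
      Nat.Partrec.Code.primrec_evaln.to_comp.comp
        (Computable.pair (Computable.pair hf (Computable.const c)) (Computable.encode.comp hp))
    have hb : Computable fun t : ℕ =>
        (c.evaln (t.unpair.1 + 1) (Encodable.encode (natToString t.unpair.2))).bind fun w =>
          (Encodable.decode (α := List Bool) w).map fun s => (natToString t.unpair.2, s) :=
      Computable.option_bind (hn (Computable.succ.comp hu))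
        (Computable.option_map (f := fun z : ℕ × ℕ => Encodable.decode (α := List Bool) z.2)
          (g := fun z s => (natToString z.1.unpair.2, s)) (Computable.decode.comp Computable.snd)
          (Computable.pair (hp.comp (Computable.fst.comp Computable.fst))
            Computable.snd).to₂).to₂
    refine (Computable.cond (Primrec.option_isSome.to_comp.comp (hn hu)) (Computable.const none)
      hb).of_eq fun t => ?_
    simp only [e]
    cases c.evaln t.unpair.1 (Encodable.encode (natToString t.unpair.2)) <;> simp
  · have h' := Nat.Partrec.Code.evaln_complete.1 ((hev p s).1 h)
    classical
    obtain ⟨u, hu⟩ : ∃ u, Nat.find h' = u + 1 := Nat.exists_eq_succ_of_ne_zero fun h0 => by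
      have := Nat.find_spec h'
      rw [h0] at this
      simp [Nat.Partrec.Code.evaln] at this
    refine ⟨Nat.pair u (stringEquivNat p), (he _ _ _).2 ?_⟩
    simp only [Nat.unpair_pair]
    refine ⟨(stringEquivNat.symm_apply_apply p).symm, ?_, _, hu ▸ Nat.find_spec h', by simp⟩
    refine Option.eq_none_iff_forall_not_mem.2 fun w hw => Nat.find_min h' (m := u) (by omega) ?_
    rwa [Part.mem_unique (Nat.Partrec.Code.evaln_complete.2 ⟨_, Nat.find_spec h'⟩)
      (Nat.Partrec.Code.evaln_sound hw)]
  · rintro ⟨t, ht⟩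
    obtain ⟨-, -, w, hw, hs⟩ := (he _ _ _).1 ht
    have hw' := Nat.Partrec.Code.evaln_sound hw
    rw [hc] at hw'
    obtain ⟨s', hs', rfl⟩ : ∃ s', s' ∈ C p ∧ Encodable.encode s' = w := by simpa using hw'
    rw [Encodable.encodek, Option.some.injEq] at hs
    exact hs ▸ hs'
  · rintro t t' ⟨p, s⟩ h h'
    obtain ⟨h1, h2, w, h3, -⟩ := (he _ _ _).1 h
    obtain ⟨h1', h2', w', h3', -⟩ := (he _ _ _).1 h'
    have hm : t.unpair.2 = t'.unpair.2 := stringEquivNat.symm.injective (h1.symm.trans h1')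
    have key : ∀ {u v x}, x ∈ c.evaln (u + 1) (Encodable.encode p) →
        c.evaln v (Encodable.encode p) = none → v ≤ u := fun hx hv => by
      by_contra hlt
      have := Nat.Partrec.Code.evaln_mono (not_le.1 hlt) hx
      rw [hv] at this
      simp at this
    rw [← Nat.pair_unpair t, ← Nat.pair_unpair t', hm, le_antisymm (key h3' h2) (key h3 h2')]

/-! ### Requests for the powers of two below the number of codewords -/

/-- Whether stage `t` of the enumeration `e` of a machine yields an element of `S_C(n, s)`. -/
def hits (e : ℕ → Option (List Bool × List Bool)) (n : ℕ) (s : List Bool) (t : ℕ) : Bool :=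
  (e t).any fun x => decide (x.1.length ≤ n ∧ x.2 = s)

theorem hits_eq_true {e : ℕ → Option (List Bool × List Bool)} {n : ℕ} {s : List Bool} {t : ℕ} :
    hits e n s t = true ↔ ∃ p, e t = some (p, s) ∧ p.length ≤ n := by
  rcases h : e t with _ | ⟨p, s'⟩
  · simp [hits, h]
  · simp only [hits, h, Option.any_some, decide_eq_true_eq, Option.some.injEq,
      Prod.mk.injEq]
    constructor
    · rintro ⟨h1, rfl⟩
      exact ⟨p, ⟨rfl, rfl⟩, h1⟩
    · rintro ⟨_, ⟨rfl, rfl⟩, h1⟩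
      exact ⟨h1, rfl⟩

/-- The rank in `S_C(n, s)` (counted from `1`) of an element which stage `t` yields. -/
def rank (e : ℕ → Option (List Bool × List Bool)) (n : ℕ) (s : List Bool) (t : ℕ) : ℕ :=
  Nat.count (fun u => hits e n s u = true) t + 1

theorem computable_rank {e : ℕ → Option (List Bool × List Bool)} (he : Computable e) :
    Computable fun x : ℕ × List Bool × ℕ => rank e x.1 x.2.1 x.2.2 := by
  have hh : Computable₂ fun (x : ℕ × List Bool × ℕ) (u : ℕ) => hits e x.1 x.2.1 u := by
    have hp : Primrec₂ fun (z : (ℕ × List Bool × ℕ) × ℕ) (y : List Bool × List Bool) =>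
        decide (y.1.length ≤ z.1.1 ∧ y.2 = z.1.2.1) := by
      exact primrecPred_iff_primrec_decide.1 ((Primrec.nat_le.comp
        (Primrec.list_length.comp (Primrec.fst.comp Primrec.snd))
        (Primrec.fst.comp (Primrec.fst.comp Primrec.fst))).and
        (Primrec.eq.comp (Primrec.snd.comp Primrec.snd)
          (Primrec.fst.comp (Primrec.snd.comp (Primrec.fst.comp Primrec.fst)))))
    refine Computable.of_eq (Computable.option_casesOn (he.comp Computable.snd)
      (Computable.const false) hp.to_comp) fun z => ?_
    cases h : e z.2 <;> simp [hits, h]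
  have hg : Computable₂ fun (x : ℕ × List Bool × ℕ) (y : ℕ × ℕ) =>
      bif hits e x.1 x.2.1 y.1 then y.2 + 1 else y.2 := by
    have h2 : Computable fun z : (ℕ × List Bool × ℕ) × ℕ × ℕ => z.2.2 :=
      Computable.snd.comp Computable.snd
    exact (Computable.cond (hh.comp Computable.fst (Computable.fst.comp Computable.snd))
      (Computable.succ.comp h2) h2).to₂
  refine (Computable.nat_rec (f := fun x : ℕ × List Bool × ℕ => x.2.2) (g := fun _ => 1)
    (Computable.snd.comp Computable.snd) (Computable.const 1) hg).of_eq fun x => ?_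
  obtain ⟨n, s, t⟩ := x
  induction t with
  | zero => simp [rank]
  | succ t ih =>
    simp only at ih ⊢
    rw [ih, rank, rank, Nat.count_succ]
    cases hits e n s t <;> simp

/-- The request with index `⟨n, t⟩`: if stage `t` of the enumeration of `C` yields the `2 ^ k`-th
element of some `S_C(n, s)`, then a codeword of length `n + 2 - k` is wanted for `b(n, s)`. The
condition `k ≤ n + 2`, which holds anyway for `2 ^ k ≤ #S_C(n, s)`, keeps the subtraction from being
truncated. -/
def request (e : ℕ → Option (List Bool × List Bool)) (b : List Bool × List Bool → List Bool)
    (i : ℕ) : Option (ℕ × List Bool) :=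
  (e i.unpair.2).bind fun x =>
    if x.1.length ≤ i.unpair.1 ∧
        2 ^ Nat.log 2 (rank e i.unpair.1 x.2 i.unpair.2) = rank e i.unpair.1 x.2 i.unpair.2 ∧
        Nat.log 2 (rank e i.unpair.1 x.2 i.unpair.2) ≤ i.unpair.1 + 2 then
      some (i.unpair.1 + 2 - Nat.log 2 (rank e i.unpair.1 x.2 i.unpair.2),
        b (natToString i.unpair.1, x.2))
    else none

theorem computable_request {e : ℕ → Option (List Bool × List Bool)} (he : Computable e)
    {b : List Bool × List Bool → List Bool} (hb : Computable b) : Computable (request e b) := by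
  -- The test and its result as a function of `n`, `p`, the rank and the output.
  have hif : Primrec fun z : (ℕ × List Bool) × ℕ × List Bool =>
      if z.1.2.length ≤ z.1.1 ∧ 2 ^ Nat.log 2 z.2.1 = z.2.1 ∧ Nat.log 2 z.2.1 ≤ z.1.1 + 2 then
        some (z.1.1 + 2 - Nat.log 2 z.2.1, z.2.2) else none := by
    have hn : Primrec fun z : (ℕ × List Bool) × ℕ × List Bool => z.1.1 :=
      Primrec.fst.comp Primrec.fst
    have hp : Primrec fun z : (ℕ × List Bool) × ℕ × List Bool => z.1.2 :=
      Primrec.snd.comp Primrec.fst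
    have hr : Primrec fun z : (ℕ × List Bool) × ℕ × List Bool => z.2.1 :=
      Primrec.fst.comp Primrec.snd
    have hk : Primrec fun z : (ℕ × List Bool) × ℕ × List Bool => Nat.log 2 z.2.1 :=
      primrec_log_two.comp hr
    have hn2 : Primrec fun z : (ℕ × List Bool) × ℕ × List Bool => z.1.1 + 2 :=
      Primrec.nat_add.comp hn (Primrec.const 2)
    exact Primrec.ite ((Primrec.nat_le.comp (Primrec.list_length.comp hp) hn).and
      ((Primrec.eq.comp (primrec_pow.comp (Primrec.const 2) hk) hr).and (Primrec.nat_le.comp hk hn2)))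
      (Primrec.option_some.comp (Primrec.pair (Primrec.nat_sub.comp hn2 hk)
        (Primrec.snd.comp Primrec.snd))) (Primrec.const none)
  have hn : Computable fun y : ℕ × List Bool × List Bool => y.1.unpair.1 :=
    Computable.fst.comp (Computable.unpair.comp Computable.fst)
  have ht : Computable fun y : ℕ × List Bool × List Bool => y.1.unpair.2 :=
    Computable.snd.comp (Computable.unpair.comp Computable.fst)
  have hs : Computable fun y : ℕ × List Bool × List Bool => y.2.2 :=
    Computable.snd.comp Computable.snd
  exact Computable.option_bind (he.comp (Computable.snd.comp Computable.unpair))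
    (hif.to_comp.comp (Computable.pair
      (Computable.pair hn (Computable.fst.comp Computable.snd))
      (Computable.pair ((computable_rank he).comp (Computable.pair hn (Computable.pair hs ht)))
        (hb.comp (Computable.pair (computable_natToString.comp hn) hs))))).to₂

/-- The powers of two up to `c` sum to at most `2 * c`. -/
theorem sum_pow_two_le (c : ℕ) :
    ∑ j ∈ Finset.range c, (if 2 ^ Nat.log 2 (j + 1) = j + 1 then j + 1 else 0) ≤ 2 * c := by
  -- With the largest power of two up to `c` in place of `c`, the bound can be proved by induction.
  suffices h : ∀ c, ∑ j ∈ Finset.range (c + 1),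
      (if 2 ^ Nat.log 2 (j + 1) = j + 1 then j + 1 else 0) + 1 ≤ 2 * 2 ^ Nat.log 2 (c + 1) by
    cases c with
    | zero => simp
    | succ c =>
      have := h c
      have := Nat.pow_log_le_self 2 (Nat.succ_ne_zero c)
      simp only [Nat.succ_eq_add_one] at this
      omega
  intro c
  induction c with
  | zero => simp
  | succ c ih =>
    rw [Finset.sum_range_succ]
    split_ifs with h
    · have hlt : Nat.log 2 (c + 1) < Nat.log 2 (c + 1 + 1) :=
        Nat.log_lt_of_lt_pow (Nat.succ_ne_zero c) (by omega)
      have := Nat.pow_le_pow_right (n := 2) (by norm_num) (Nat.succ_le_of_lt hlt)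
      rw [Nat.succ_eq_add_one, pow_succ] at this
      omega
    · have := Nat.pow_le_pow_right (n := 2) (by norm_num)
        (Nat.log_mono_right (b := 2) (Nat.le_succ (c + 1)))
      simp only [Nat.succ_eq_add_one] at this
      omega

/-! ### The total weight of the requests -/

theorem tsum_length_le (L : ℕ) :
    ∑' n : ℕ, (if L ≤ n then (2⁻¹ : ℝ≥0∞) ^ (n + 1) else 0) = 2⁻¹ ^ L := by
  have hinj : Function.Injective fun m : ℕ => m + L := add_left_injective L
  rw [← hinj.tsum_eq]
  · simp only [Nat.le_add_left, if_true]
    have h : ∀ m : ℕ, (2⁻¹ : ℝ≥0∞) ^ (m + L + 1) = 2⁻¹ ^ L * 2⁻¹ ^ (m + 1) := fun m => by ring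
    simp_rw [h]
    rw [ENNReal.tsum_mul_left, ENNReal.tsum_geometric_add_one, ENNReal.one_sub_inv_two, inv_inv,
      ENNReal.inv_mul_cancel (by norm_num) (by norm_num), mul_one]
  · intro n hn
    have : L ≤ n := by
      by_contra h
      simp [h] at hn
    exact ⟨n - L, Nat.sub_add_cancel this⟩

/-- The weight of the requests for one pair `(n, s)` is at most `2 ^ (-n) * #S_C(n, s) / 2`. -/
theorem tsum_weight_le_tsum_hits (e : ℕ → Option (List Bool × List Bool)) (n : ℕ)
    (s : List Bool) :
    ∑' t, (if hits e n s t = true ∧ 2 ^ Nat.log 2 (rank e n s t) = rank e n s t then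
      (rank e n s t : ℝ≥0∞) * 2⁻¹ ^ (n + 2) else 0) ≤
    ∑' t, (if hits e n s t = true then (2⁻¹ : ℝ≥0∞) ^ (n + 1) else 0) := by
  have hcount : ∀ T, ∑ t ∈ Finset.range T,
      (if hits e n s t = true ∧ 2 ^ Nat.log 2 (rank e n s t) = rank e n s t then
        (rank e n s t : ℝ≥0∞) * 2⁻¹ ^ (n + 2) else 0) =
      ((∑ j ∈ Finset.range (Nat.count (fun u => hits e n s u = true) T),
        (if 2 ^ Nat.log 2 (j + 1) = j + 1 then j + 1 else 0) : ℕ) : ℝ≥0∞) * 2⁻¹ ^ (n + 2) := by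
    intro T
    induction T with
    | zero => simp
    | succ T ih =>
      rw [Finset.sum_range_succ, ih, Nat.count_succ]
      by_cases h : hits e n s T = true
      · rw [if_pos h, Finset.sum_range_succ, Nat.cast_add, add_mul]
        simp only [h, true_and, rank]
        split_ifs <;> simp
      · simp [h]
  have hhits : ∀ T, ∑ t ∈ Finset.range T,
      (if hits e n s t = true then (2⁻¹ : ℝ≥0∞) ^ (n + 1) else 0) =
      (Nat.count (fun u => hits e n s u = true) T : ℝ≥0∞) * 2⁻¹ ^ (n + 1) := by
    intro T
    rw [← Finset.sum_filter, Finset.sum_const, nsmul_eq_mul, Nat.count_eq_card_filter_range]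
  refine ENNReal.tsum_le_of_sum_range_le fun T => ?_
  refine le_trans ?_ ((hhits T).symm.le.trans (ENNReal.sum_le_tsum _))
  · rw [hcount]
    have h2 : (2⁻¹ : ℝ≥0∞) ^ (n + 1) = 2 * 2⁻¹ ^ (n + 2) := by
      rw [pow_succ _ (n + 1), mul_comm, mul_assoc,
        ENNReal.inv_mul_cancel (by norm_num) (by norm_num), mul_one]
    rw [h2, ← mul_assoc]
    gcongr
    calc _ ≤ ((2 * Nat.count (fun u => hits e n s u = true) T : ℕ) : ℝ≥0∞) := by
          exact_mod_cast sum_pow_two_le _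
      _ = _ := by push_cast; ring

/-- The Kraft inequality for the domain of `C`, in terms of an enumeration of its graph. -/
theorem tsum_enumeration_le {C : List Bool →. List Bool} (hC : IsPrefixFreeMachine C)
    {e : ℕ → Option (List Bool × List Bool)} (he : ∀ p s, s ∈ C p ↔ ∃ t, e t = some (p, s))
    (hinj : ∀ t t' x, e t = some x → e t' = some x → t = t') :
    ∑' t, (e t).elim 0 (fun x => (2⁻¹ : ℝ≥0∞) ^ x.1.length) ≤ 1 := by
  have hsub : Function.support (fun t => (e t).elim 0 fun x => (2⁻¹ : ℝ≥0∞) ^ x.1.length) ⊆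
      {t | (e t).isSome} := fun t ht => by
    cases h : e t <;> simp_all
  rw [← tsum_subtype_eq_of_support_subset hsub]
  refine le_trans (le_of_eq (tsum_congr fun t => ?_))
    (kraft_inequality (fun t : {t | (e t).isSome} => ((e t).get t.2).1) fun i j hij => ?_)
  · obtain ⟨x, hx⟩ := Option.isSome_iff_exists.1 t.2
    simp [hx]
  · obtain ⟨⟨p, s⟩, hp⟩ := Option.isSome_iff_exists.1 i.2
    obtain ⟨⟨q, s'⟩, hq⟩ := Option.isSome_iff_exists.1 j.2
    simp only [hp, hq, Option.get_some] at hij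
    have h1 := (he p s).2 ⟨i, hp⟩
    have h2 := (he q s').2 ⟨j, hq⟩
    obtain rfl := hC.prefixFree p (Part.dom_iff_mem.2 ⟨s, h1⟩) q (Part.dom_iff_mem.2 ⟨s', h2⟩) hij
    obtain rfl := Part.mem_unique h1 h2
    exact Subtype.ext (hinj _ _ _ hp hq)

/-- The requests have total weight at most `1`: the weights `2 ^ (-(n + 1))` of the elements `p` of
all the `S_C(n, s)` bound it, and they sum to `2 ^ (-|p|)` for each `p` in the domain of `C`. -/
theorem tsum_weight_request_le {C : List Bool →. List Bool} (hC : IsPrefixFreeMachine C)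
    {e : ℕ → Option (List Bool × List Bool)} (he : ∀ p s, s ∈ C p ↔ ∃ t, e t = some (p, s))
    (hinj : ∀ t t' x, e t = some x → e t' = some x → t = t')
    (b : List Bool × List Bool → List Bool) :
    ∑' i, (weight (request e b i) : ℝ≥0∞) ≤ 1 := by
  have hterm : ∀ n t, (weight (request e b (Nat.pair n t)) : ℝ≥0∞) ≤
      ∑' s, (if hits e n s t = true ∧ 2 ^ Nat.log 2 (rank e n s t) = rank e n s t then
        (rank e n s t : ℝ≥0∞) * 2⁻¹ ^ (n + 2) else 0) := by
    intro n t
    rcases h : e t with _ | ⟨p, s⟩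
    · simp [request, h, weight]
    · refine le_trans ?_ (ENNReal.le_tsum s)
      simp only [request, Nat.unpair_pair, h, Option.bind_some]
      split_ifs with h1 h2 h2
      · obtain ⟨-, h3, h4⟩ := h1
        simp only [weight, Option.elim_some]
        have hk : (n + 2) = (n + 2 - Nat.log 2 (rank e n s t)) + Nat.log 2 (rank e n s t) := by
          omega
        generalize Nat.log 2 (rank e n s t) = k at *
        rw [← h3]
        conv_rhs => rw [hk, pow_add]
        push_cast
        rw [mul_left_comm, ← mul_pow, ENNReal.mul_inv_cancel (by norm_num) (by norm_num), one_pow,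
          mul_one]
      · exact absurd ⟨hits_eq_true.2 ⟨p, h, h1.1⟩, h1.2.1⟩ h2
      · simp [weight]
      · simp [weight]
  calc ∑' i, (weight (request e b i) : ℝ≥0∞)
      = ∑' z : ℕ × ℕ, (weight (request e b (Nat.pair z.1 z.2)) : ℝ≥0∞) :=
        (Nat.pairEquiv.tsum_eq fun i => (weight (request e b i) : ℝ≥0∞)).symm
    _ = ∑' n, ∑' t, (weight (request e b (Nat.pair n t)) : ℝ≥0∞) :=
        ENNReal.tsum_prod (f := fun n t => (weight (request e b (Nat.pair n t)) : ℝ≥0∞))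
    _ ≤ ∑' n, ∑' t, ∑' s,
        (if hits e n s t = true ∧ 2 ^ Nat.log 2 (rank e n s t) = rank e n s t then
          (rank e n s t : ℝ≥0∞) * 2⁻¹ ^ (n + 2) else 0) :=
        ENNReal.tsum_le_tsum fun n => ENNReal.tsum_le_tsum fun t => hterm n t
    _ = ∑' n, ∑' s, ∑' t,
        (if hits e n s t = true ∧ 2 ^ Nat.log 2 (rank e n s t) = rank e n s t then
          (rank e n s t : ℝ≥0∞) * 2⁻¹ ^ (n + 2) else 0) :=
        tsum_congr fun n => ENNReal.tsum_comm
    _ ≤ ∑' n, ∑' s, ∑' t, (if hits e n s t = true then (2⁻¹ : ℝ≥0∞) ^ (n + 1) else 0) :=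
        ENNReal.tsum_le_tsum fun n => ENNReal.tsum_le_tsum fun s => tsum_weight_le_tsum_hits e n s
    _ = ∑' t, ∑' n, ∑' s, (if hits e n s t = true then (2⁻¹ : ℝ≥0∞) ^ (n + 1) else 0) := by
        rw [ENNReal.tsum_comm (α := ℕ) (β := ℕ)]
        exact tsum_congr fun n => ENNReal.tsum_comm
    _ = ∑' t, (e t).elim 0 (fun x => (2⁻¹ : ℝ≥0∞) ^ x.1.length) := by
        refine tsum_congr fun t => ?_
        rcases h : e t with _ | ⟨p, s⟩
        · simp [hits, h]
        · rw [Option.elim_some, ← tsum_length_le]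
          refine tsum_congr fun n => ?_
          rw [tsum_eq_single s fun s' hs' => by simp [hits, h, hs'.symm]]
          simp [hits, h]
    _ ≤ 1 := tsum_enumeration_le hC he hinj

/-- The hits for `(n, s)` take all ranks up to `#S_C(n, s)`, as each codeword is enumerated. -/
theorem exists_hit_of_lt_ncard {C : List Bool →. List Bool}
    {e : ℕ → Option (List Bool × List Bool)} (he : ∀ p s, s ∈ C p ↔ ∃ t, e t = some (p, s))
    {n : ℕ} {s : List Bool} {j : ℕ} (hj : j < (codewords C n s).ncard) :
    ∃ t, hits e n s t = true ∧ rank e n s t = j + 1 := by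
  have hlt : ∀ hf : (Set.ofPred fun t => hits e n s t = true).Finite, j < hf.toFinset.card := by
    intro hf
    refine hj.trans_le ?_
    rw [← Set.ncard_eq_toFinset_card _ hf]
    choose! f hf' using fun p (hp : p ∈ codewords C n s) => (he p s).1 hp.2
    refine Set.ncard_le_ncard_of_injOn f (fun p hp => ?_) (fun p hp q hq hpq => ?_) hf
    · exact hits_eq_true.2 ⟨p, hf' p hp, hp.1⟩
    · have := (hf' p hp).symm.trans (hpq ▸ hf' q hq)
      simpa using this
  exact ⟨_, Nat.nth_mem j hlt, by rw [rank, Nat.count_nth hlt]⟩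

theorem ncard_codewords_le (C : List Bool →. List Bool) (n : ℕ) (s : List Bool) :
    (codewords C n s).ncard ≤ 2 ^ (n + 1) := by
  rw [← Set.ncard_coe_finset (Finset.range (2 ^ (n + 1))) |>.trans (Finset.card_range _)]
  refine Set.ncard_le_ncard_of_injOn oneConcat (fun p hp => ?_) oneConcat_injective.injOn
    (Finset.finite_toSet _)
  have h := (two_pow_length_le_oneConcat p).2
  have h' := Nat.pow_le_pow_right (n := 2) (by norm_num) hp.1
  rw [Finset.coe_range, Set.mem_Iio, pow_succ']
  omega

/-! ### Complexity with respect to an optimal machine -/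

/-- The machine with the empty string as its only program and `o` as its output, on account of which
`H U o` is finite for an optimal machine `U`. -/
theorem isPrefixFreeMachine_const (o : List Bool) :
    IsPrefixFreeMachine fun q => ((if q = [] then some o else none : Option (List Bool)) :
      Part (List Bool)) where
  partrec := ((Primrec.ite (Primrec.eq.comp Primrec.id (Primrec.const []))
    (Primrec.const (some o)) (Primrec.const none)).to_comp).ofOption
  prefixFree := by
    have h : ∀ q : List Bool, q ∈ PFun.Dom (fun q : List Bool =>
        ((if q = [] then some o else none : Option (List Bool)) : Part (List Bool))) → q = [] := by
      intro q hq
      obtain ⟨y, hy⟩ := (PFun.mem_dom _ _).1 hq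
      by_contra hne
      simp [hne] at hy
    intro p hp q hq _
    rw [h p hp, h q hq]

theorem H_le {U : List Bool →. List Bool} {q o : List Bool} (h : o ∈ U q) : H U o ≤ q.length :=
  iInf₂_le q h

theorem exists_H_eq {U : List Bool →. List Bool} (hU : IsOptimal U) (o : List Bool) :
    ∃ h : ℕ, H U o = h := by
  obtain ⟨d, hd⟩ := hU.optimal _ (isPrefixFreeMachine_const o)
  obtain ⟨q, hq, -⟩ := hd [] o (by simp)
  obtain ⟨h, hh⟩ := ENat.ne_top_iff_exists.1 (ne_top_of_le_ne_top (ENat.natCast_ne_top _) (H_le hq))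
  exact ⟨h, hh.symm⟩

end AIT

theorem mainTheorem2
    (U : List Bool →. List Bool) (hU : AIT.IsOptimal U)
    (b : List Bool × List Bool → List Bool) (hb : Function.Bijective b) (hbc : Computable b)
    (C : List Bool →. List Bool) (hC : AIT.IsPrefixFreeMachine C) :
    ∃ d : ℕ, ∀ (n : ℕ) (s : List Bool), ∃ h : ℕ,
      AIT.H U (b (AIT.stringEquivNat.symm n, s)) = (h : ℕ∞) ∧
      ((AIT.codewords C n s).ncard : ℝ) ≤ (2 : ℝ) ^ ((n : ℤ) - (h : ℤ) + (d : ℤ)) := by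
  obtain ⟨e, hec, he, hinj⟩ := AIT.exists_enumeration hC.partrec
  obtain ⟨M, hM, hMR⟩ := AIT.exists_prefixFreeMachine_of_requests (AIT.computable_request hec hbc)
    (AIT.tsum_weight_request_le hC he hinj b)
  obtain ⟨d, hd⟩ := hU.optimal M hM
  refine ⟨d + 4, fun n s => ?_⟩
  obtain ⟨h, hh⟩ := AIT.exists_H_eq hU (b (AIT.stringEquivNat.symm n, s))
  refine ⟨h, hh, ?_⟩
  rcases Nat.eq_zero_or_pos (AIT.codewords C n s).ncard with h0 | hpos
  · rw [h0, Nat.cast_zero]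
    positivity
  -- The request made at the last power of two, `2 ^ k`, up to the number of codewords.
  obtain ⟨k, hk⟩ : ∃ k, Nat.log 2 (AIT.codewords C n s).ncard = k := ⟨_, rfl⟩
  have hk1 : 2 ^ k ≤ (AIT.codewords C n s).ncard := hk ▸ Nat.pow_log_le_self 2 hpos.ne'
  have hk2 : (AIT.codewords C n s).ncard < 2 ^ (k + 1) :=
    hk ▸ Nat.lt_pow_succ_log_self (by norm_num) _
  have hkn : k ≤ n + 1 := (Nat.pow_le_pow_iff_right (by norm_num)).1
    (hk1.trans (AIT.ncard_codewords_le C n s))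
  have hk0 : 0 < 2 ^ k := by positivity
  obtain ⟨t, ht, hrank⟩ := AIT.exists_hit_of_lt_ncard he (j := 2 ^ k - 1) (n := n) (s := s)
    (by omega)
  rw [Nat.sub_add_cancel hk0] at hrank
  obtain ⟨p, hp, hpn⟩ := AIT.hits_eq_true.1 ht
  have hreq : AIT.request e b (Nat.pair n t) =
      some (n + 2 - k, b (AIT.stringEquivNat.symm n, s)) := by
    have hlog : Nat.log 2 (2 ^ k) = k := Nat.log_pow (by norm_num) k
    simp only [AIT.request, Nat.unpair_pair, hp, Option.bind_some, hrank, hlog]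
    exact if_pos ⟨hpn, trivial, by omega⟩
  obtain ⟨q, hq, hql⟩ := hMR _ _ _ hreq
  obtain ⟨q', hq', hql'⟩ := hd q _ hq
  have hle : h ≤ q'.length := by
    have := AIT.H_le hq'
    rw [hh] at this
    exact_mod_cast this
  calc ((AIT.codewords C n s).ncard : ℝ) ≤ (2 : ℝ) ^ (k + 1) := by exact_mod_cast hk2.le
    _ = (2 : ℝ) ^ ((k + 1 : ℕ) : ℤ) := (zpow_natCast _ _).symm
    _ ≤ _ := zpow_le_zpow_right₀ (by norm_num) (by push_cast; omega)
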